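/- Let $M$ be a compact oriented smooth Riemannian manifold of dimension $n\ge 1$, possibly with boundary, with metric $\langle\cdot,\cdot\rangle$, Riemannian volume form $\mathrm{vol}$ and Hodge star $*$ (normalised by $\beta\wedge *\alpha=\langle\beta,\alpha\rangle\,\mathrm{vol}$, $*1=\mathrm{vol}$), and let $\Omega^k(M)$ be the space of smooth $k$-forms. For $\mu\in\Omega^n(M)$ regard $*\mu$ as a function. For a functional $F$ on $\Omega^k(M)$ and $a\in\Omega^k(M)$, the variational derivative $\delta_aF$ is the element $e\in\Omega^{n-k}(M)$ such that $\frac{d}{d\varepsilon}\big|_{\varepsilon=0}F(a+\varepsilon\,\delta a)=\int_M\delta a\wedge e$ for all $\delta a\in\Omega^k(M)$. For $\alpha\in\Omega^1(M)$ and $\mu\in\Omega^n(M)$ with $*\mu$ nowhere zero, let the kinetic energy in momentum variables be $H_k(\alpha,\mu)=\int_M\frac{1}{2(*\mu)}\,\alpha\wedge*\alpha$. The change of variables $\Phi(\alpha,\mu)=(\tilde v,\mu):=\big(\frac{\alpha}{*\mu},\mu\big)$ is a bijection of the set of pairs $(\alpha,\mu)\in\Omega^1(M)\times\Omega^n(M)$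 with $*\mu$ nowhere zero onto itself, and in the velocity variables $(\tilde v,\mu)$ the kinetic energy is $$H_k(\tilde v,\mu)=\int_M\tfrac12(*\mu)\,\tilde v\wedge*\tilde v,$$ that is, $H_k(\alpha,\mu)=\int_M\tfrac12(*\mu)\,\tilde v\wedge*\tilde v$ whenever $(\tilde v,\mu)=\Phi(\alpha,\mu)$. For all $\tilde v\in\Omega^1(M)$ and $\mu\in\Omega^n(M)$, the variational derivatives $\delta_{\tilde v}H_k\in\Omega^{n-1}(M)$ and $\delta_\mu H_k\in\Omega^0(M)$ of the functional $H_k(\tilde v,\mu)=\int_M\tfrac12(*\mu)\,\tilde v\wedge*\tilde v$ exist, are unique, and are given by $$\delta_{\tilde v}H_k=(*\mu)*\tilde v=\iota_v\mu,\qquad \delta_\mu H_k=\tfrac12\,\iota_v\tilde v,$$ where $v$ is the vector field with $\tilde v=\langle v,\cdot\rangle$. -/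

import Mathlib

open scoped Manifold ContDiff Topology Bundle
open Module MeasureTheory Bundle

/-! ### Linear algebra of alternating forms -/

section LinearAlgebra

variable {V : Type*}

/-- The wedge product `α ∧ β` of alternating forms on `V`, as a form of degree `p = k + l`; it is
the sum over `(k, l)`-shuffles, so that `(dx ∧ dy) (∂x, ∂y) = 1`. -/
noncomputable def altWedge [AddCommGroup V] [Module ℝ V] {k l p : ℕ} (h : k + l = p)
    (α : V [⋀^Fin k]→ₗ[ℝ] ℝ) (β : V [⋀^Fin l]→ₗ[ℝ] ℝ) : V [⋀^Fin p]→ₗ[ℝ] ℝ :=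
  ((LinearMap.mul' ℝ ℝ).compAlternatingMap (α.domCoprod β)).domDomCongr
    (finSumFinEquiv.trans (finCongr h))

theorem append_update_right {k l : ℕ} (u : Fin k → V) (w : Fin l → V) [DecidableEq (Fin l)]
    (i : Fin l) (z : V) :
    Fin.append u (Function.update w i z)
      = Function.update (Fin.append u w) (Fin.natAdd k i) z := by
  ext j
  refine Fin.addCases (fun a => ?_) (fun b => ?_) j
  · have : Fin.castAdd l a ≠ Fin.natAdd k i := by
      intro hh
      have := congrArg Fin.val hh
      simp at this
      omega
    simp [Function.update_of_ne this]
  · by_cases hb : b = i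
    · subst hb
      simp
    · have : Fin.natAdd k b ≠ Fin.natAdd k i := fun hh => hb (by simpa using hh)
      rw [Function.update_of_ne this, Fin.append_right, Fin.append_right,
        Function.update_of_ne hb]

/-- Insert the vectors `u` into the first `k` slots of a form of degree `n = k + l`:
`w ↦ η (u₁, …, u_k, w₁, …, w_l)`. -/
def altInsert [AddCommGroup V] [Module ℝ V] {k l n : ℕ} (h : k + l = n)
    (η : V [⋀^Fin n]→ₗ[ℝ] ℝ) (u : Fin k → V) : V [⋀^Fin l]→ₗ[ℝ] ℝ where
  toFun w := η.domDomCongr (finCongr h.symm) (Fin.append u w)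
  map_update_add' w i x y := by
    simp only [append_update_right, AlternatingMap.map_update_add]
  map_update_smul' w i c x := by
    simp only [append_update_right, AlternatingMap.map_update_smul]
  map_eq_zero_of_eq' w i j hw hij := by
    refine AlternatingMap.map_eq_zero_of_eq _ _ (i := Fin.natAdd k i) (j := Fin.natAdd k j)
      (by simpa using hw) (fun hh => hij (by simpa using hh))

/-- The Hodge star of an oriented inner product space of dimension `n = k + l`:
`(*α) (w₁, …, w_l) = (1 / k!) ∑ α (e_{i₁}, …, e_{i_k}) vol (e_{i₁}, …, e_{i_k}, w₁, …, w_l)`, the sum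
being over all `k`-tuples of vectors of an orthonormal basis `e`. This is the convention
`β ∧ *α = ⟨β, α⟩ vol`, with `*1 = vol`. -/
noncomputable def altHodge [NormedAddCommGroup V] [InnerProductSpace ℝ V] [FiniteDimensional ℝ V]
    {n : ℕ} [Fact (finrank ℝ V = n)] (o : Orientation ℝ V (Fin n)) {k l : ℕ} (h : k + l = n)
    (α : V [⋀^Fin k]→ₗ[ℝ] ℝ) : V [⋀^Fin l]→ₗ[ℝ] ℝ :=
  ((k.factorial : ℝ)⁻¹) • ∑ J : Fin k → Fin (finrank ℝ V),
    α (fun a => stdOrthonormalBasis ℝ V (J a)) •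
      altInsert h o.volumeForm (fun a => stdOrthonormalBasis ℝ V (J a))

end LinearAlgebra

/-! ### Differential forms on a manifold -/

section Manifold

variable {n : ℕ} {H : Type*} [TopologicalSpace H]
  (I : ModelWithCorners ℝ (EuclideanSpace ℝ (Fin n)) H)
  (M : Type*) [TopologicalSpace M] [ChartedSpace H M]

instance tangentSpace_finiteDimensional (x : M) : FiniteDimensional ℝ (TangentSpace I x) :=
  inferInstanceAs (FiniteDimensional ℝ (EuclideanSpace ℝ (Fin n)))

instance tangentSpace_fact_finrank (x : M) : Fact (finrank ℝ (TangentSpace I x) = n) :=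
  ⟨(finrank_euclideanSpace_fin : finrank ℝ (EuclideanSpace ℝ (Fin n)) = n)⟩

/-- Differential `k`-forms on `M`; no regularity is included (see `IsSmoothForm`). -/
abbrev DForm (k : ℕ) : Type _ := ∀ x : M, TangentSpace I x [⋀^Fin k]→ₗ[ℝ] ℝ

variable {M} [IsManifold I ∞ M]

/-- The coordinate frame `∂₁, …, ∂ₙ` at `x` of the chart around `c` (meaningful for `x` in the
domain of that chart): the images of the standard basis vectors under the inverse of the
differential of the chart. -/
noncomputable def coordFrame (c x : M) (j : Fin n) : TangentSpace I x :=
  (trivializationAt (EuclideanSpace ℝ (Fin n)) (TangentSpace I : M → Type _) c).symmL ℝ x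
    (EuclideanSpace.basisFun (Fin n) ℝ j)

variable {I}

/-- A form is smooth if its components in every chart are smooth functions. -/
def IsSmoothForm {k : ℕ} (η : DForm I M k) : Prop :=
  ∀ (c : M) (J : Fin k → Fin n),
    ContMDiffOn I 𝓘(ℝ) ∞ (fun x => η x (fun a => coordFrame I c x (J a))) (chartAt H c).source

/-- The vectors `X₁, …, Xₙ` form a basis of `T_x M` that defines the orientation `o`. -/
def IsPositiveFrame {x : M} (o : Orientation ℝ (TangentSpace I x) (Fin n))
    (X : Fin n → TangentSpace I x) : Prop :=
  ∃ b : Basis (Fin n) ℝ (TangentSpace I x), (∀ j, b j = X j) ∧ b.orientation = o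

variable (I M) in
/-- An orientation of the manifold `M`: orientations of all the tangent spaces, locally constant in
the charts. -/
structure ManifoldOrientation where
  /-- The orientation of the tangent space at `x`. -/
  at' : ∀ x : M, Orientation ℝ (TangentSpace I x) (Fin n)
  locally_constant : ∀ c : M, ∀ x ∈ (chartAt H c).source, ∀ᶠ y in 𝓝 x,
    (IsPositiveFrame (at' y) (coordFrame I c y) ↔ IsPositiveFrame (at' x) (coordFrame I c x))

open Classical in
/-- `1` if the chart around `c` preserves the orientation at `x`, and `-1` otherwise. -/
noncomputable def chartSign (o : ManifoldOrientation I M) (c x : M) : ℝ :=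
  if IsPositiveFrame (o.at' x) (coordFrame I c x) then 1 else -1

/-- The wedge product of differential forms, as a form of degree `p = k + l`. -/
noncomputable def wedge {k l p : ℕ} (h : k + l = p) (α : DForm I M k) (β : DForm I M l) :
    DForm I M p :=
  fun x => altWedge h (α x) (β x)

/-- The interior product `ι_v η`. -/
noncomputable def interiorProduct {k : ℕ} (v : ∀ x : M, TangentSpace I x)
    (η : DForm I M (k + 1)) : DForm I M k :=
  fun x => (η x).curryLeft (v x)

/-- The product of a function and a form. -/
noncomputable def fmul {k : ℕ} (f : M → ℝ) (η : DForm I M k) : DForm I M k :=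
  fun x => f x • η x

section Integral

variable [T2Space M] [CompactSpace M]

variable (I M) in
/-- A smooth partition of unity subordinate to the cover of `M` by the domains of the charts. -/
noncomputable def chartPartition : SmoothPartitionOfUnity M I M Set.univ :=
  (SmoothPartitionOfUnity.exists_isSubordinate_chartAt_source I M).choose

/-- The integral over the compact oriented manifold `M` of a form of top degree, by a partition of
unity `(ρ_c)` subordinate to the charts `φ_c`:
`∫_M η = ∑_c ∫_{im φ_c} ± (ρ_c η (∂₁, …, ∂ₙ)) ∘ φ_c⁻¹ dy`, where `∂₁, …, ∂ₙ` is the coordinate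
frame of `φ_c` and the sign is that of the chart. All but finitely many `ρ_c` vanish. -/
noncomputable def integralForm (o : ManifoldOrientation I M) (η : DForm I M n) : ℝ :=
  ∑ᶠ c : M, ∫ y in (extChartAt I c).target,
    chartSign o c ((extChartAt I c).symm y) * chartPartition I M c ((extChartAt I c).symm y) *
      η ((extChartAt I c).symm y) (coordFrame I c ((extChartAt I c).symm y))

/-- `e` is the variational derivative at `a`, with respect to the pairing `∫_M δ ∧ e` of `k`-forms
and `l`-forms (`k + l = n`), of the functional `F` of `k`-forms: `e` is a smooth `l`-form and
`d/dε F (a + ε δ) = ∫_M δ ∧ e` at `ε = 0` for every smooth `k`-form `δ`. -/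
def IsVariationalDerivative (o : ManifoldOrientation I M) {k l : ℕ} (h : k + l = n)
    (F : DForm I M k → ℝ) (a : DForm I M k) (e : DForm I M l) : Prop :=
  IsSmoothForm e ∧ ∀ δ : DForm I M k, IsSmoothForm δ →
    HasDerivAt (fun ε : ℝ => F (a + ε • δ)) (integralForm o (wedge h δ e)) 0

end Integral

section Riemannian

variable [RiemannianBundle (fun x : M => TangentSpace I x)]

/-- The Hodge star on differential forms of a Riemannian manifold of dimension `n = k + l`. -/
noncomputable def hodge (o : ManifoldOrientation I M) {k l : ℕ} (h : k + l = n)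
    (α : DForm I M k) : DForm I M l :=
  fun x => altHodge (o.at' x) h (α x)

/-- The function `*μ`, for a form `μ` of top degree. -/
noncomputable def density (o : ManifoldOrientation I M) (μ : DForm I M n) : M → ℝ :=
  fun x => hodge o (Nat.add_zero n) μ x Fin.elim0

/-- The vector field `v` with `ṽ = ⟨v, ·⟩`, for a 1-form `ṽ`. -/
noncomputable def sharp (w : DForm I M 1) : ∀ x : M, TangentSpace I x :=
  fun x => (InnerProductSpace.toDual ℝ (TangentSpace I x)).symm
    (LinearMap.toContinuousLinearMap
      ((AlternatingMap.ofSubsingleton ℝ (TangentSpace I x) ℝ (0 : Fin 1)).symm (w x)))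

end Riemannian

end Manifold

/-! ### Kinetic energy -/

section KineticEnergy

variable {m : ℕ} {H : Type*} [TopologicalSpace H]
  {I : ModelWithCorners ℝ (EuclideanSpace ℝ (Fin (m + 1))) H}
  {M : Type*} [TopologicalSpace M] [ChartedSpace H M] [IsManifold I ∞ M]
  [RiemannianBundle (fun x : M => TangentSpace I x)]

/-- Smooth pairs of a 1-form and a top form `μ` for which the function `*μ` has no zero. -/
def kineticStates (o : ManifoldOrientation I M) : Set (DForm I M 1 × DForm I M (m + 1)) :=
  {s | IsSmoothForm s.1 ∧ IsSmoothForm s.2 ∧ ∀ x, density o s.2 x ≠ 0}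

/-- The change of variables `(α, μ) ↦ (α / *μ, μ)` from momentum to velocity. -/
noncomputable def velocityMap (o : ManifoldOrientation I M)
    (s : DForm I M 1 × DForm I M (m + 1)) : DForm I M 1 × DForm I M (m + 1) :=
  (fmul (fun x => 1 / density o s.2 x) s.1, s.2)

variable [T2Space M] [CompactSpace M]

/-- The kinetic energy `∫_M (1 / (2 *μ)) α ∧ *α` in terms of the momentum `α` and the mass
form `μ`. -/
noncomputable def kineticEnergyMomentum (o : ManifoldOrientation I M) (α : DForm I M 1)
    (μ : DForm I M (m + 1)) : ℝ :=
  integralForm o (fmul (fun x => 1 / (2 * density o μ x))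
    (wedge (Nat.add_comm 1 m) α (hodge o (Nat.add_comm 1 m) α)))

/-- The functional `∫_M (1/2) (*μ) w ∧ *w` of the velocity 1-form `w` and the mass form `μ`. -/
noncomputable def kineticEnergyVelocity (o : ManifoldOrientation I M) (w : DForm I M 1)
    (μ : DForm I M (m + 1)) : ℝ :=
  integralForm o (fmul (fun x => 1 / 2 * density o μ x)
    (wedge (Nat.add_comm 1 m) w (hodge o (Nat.add_comm 1 m) w)))

end KineticEnergy

section LinearAlgebra

variable {V : Type*}

section Wedge

variable [AddCommGroup V] [Module ℝ V]

theorem altWedge_apply {k l p : ℕ} (h : k + l = p) (α : V [⋀^Fin k]→ₗ[ℝ] ℝ)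
    (β : V [⋀^Fin l]→ₗ[ℝ] ℝ) (X : Fin p → V) :
    altWedge h α β X = ((k.factorial * l.factorial : ℕ) : ℝ)⁻¹ *
      ∑ σ : Equiv.Perm (Fin k ⊕ Fin l), ((Equiv.Perm.sign σ : ℤ) : ℝ) *
        (α (fun a => X (finCongr h (finSumFinEquiv (σ (Sum.inl a))))) *
          β (fun b => X (finCongr h (finSumFinEquiv (σ (Sum.inr b)))))) := by
  have key := MultilinearMap.domCoprod_alternization_eq α β
  have key2 := congrArg (fun f => LinearMap.mul' ℝ ℝ (f
    (fun i => X (finCongr h (finSumFinEquiv i))))) key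
  simp only [MultilinearMap.alternatization_apply, map_sum, Fintype.card_fin] at key2
  have hne : ((k.factorial * l.factorial : ℕ) : ℝ) ≠ 0 := by positivity
  rw [eq_inv_mul_iff_mul_eq₀ hne]
  calc _ = _ := ?_
    _ = _ := key2.symm
    _ = _ := ?_
  · rw [AlternatingMap.smul_apply, map_nsmul, nsmul_eq_mul]
    rfl
  · refine Finset.sum_congr rfl fun σ _ => ?_
    rw [Units.smul_def, map_zsmul, zsmul_eq_mul]
    rfl

theorem altWedge_add_left {k l p : ℕ} (h : k + l = p) (α α' : V [⋀^Fin k]→ₗ[ℝ] ℝ)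
    (β : V [⋀^Fin l]→ₗ[ℝ] ℝ) :
    altWedge h (α + α') β = altWedge h α β + altWedge h α' β := by
  ext X
  simp only [altWedge_apply, AlternatingMap.add_apply, add_mul, mul_add, Finset.sum_add_distrib]

theorem altWedge_sub_right {k l p : ℕ} (h : k + l = p) (α : V [⋀^Fin k]→ₗ[ℝ] ℝ)
    (β β' : V [⋀^Fin l]→ₗ[ℝ] ℝ) :
    altWedge h α (β - β') = altWedge h α β - altWedge h α β' := by
  ext X
  simp only [altWedge_apply, AlternatingMap.sub_apply, mul_sub, Finset.sum_sub_distrib]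

theorem altWedge_smul_left {k l p : ℕ} (h : k + l = p) (c : ℝ) (α : V [⋀^Fin k]→ₗ[ℝ] ℝ)
    (β : V [⋀^Fin l]→ₗ[ℝ] ℝ) :
    altWedge h (c • α) β = c • altWedge h α β := by
  ext X
  simp only [altWedge_apply, AlternatingMap.smul_apply, smul_eq_mul, Finset.mul_sum]
  exact Finset.sum_congr rfl fun σ _ => by ring

theorem altWedge_smul_right {k l p : ℕ} (h : k + l = p) (c : ℝ) (α : V [⋀^Fin k]→ₗ[ℝ] ℝ)
    (β : V [⋀^Fin l]→ₗ[ℝ] ℝ) :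
    altWedge h α (c • β) = c • altWedge h α β := by
  ext X
  simp only [altWedge_apply, AlternatingMap.smul_apply, smul_eq_mul, Finset.mul_sum]
  exact Finset.sum_congr rfl fun σ _ => by ring

/-- The wedge product with a `0`-form is the product with its value. -/
theorem altWedge_zero_form {n : ℕ} (α : V [⋀^Fin n]→ₗ[ℝ] ℝ) (f : V [⋀^Fin 0]→ₗ[ℝ] ℝ) :
    altWedge (Nat.add_zero n) α f = f Fin.elim0 • α := by
  ext X
  rw [altWedge_apply, inv_mul_eq_iff_eq_mul₀ (by positivity)]
  have hterm : ∀ σ : Equiv.Perm (Fin n ⊕ Fin 0), ((Equiv.Perm.sign σ : ℤ) : ℝ) *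
        (α (fun a => X (finCongr (Nat.add_zero n) (finSumFinEquiv (σ (Sum.inl a))))) *
          f (fun b => X (finCongr (Nat.add_zero n) (finSumFinEquiv (σ (Sum.inr b))))))
        = α X * f Fin.elim0 := by
    intro σ
    have hf : (fun b => X (finCongr (Nat.add_zero n) (finSumFinEquiv (σ (Sum.inr b)))))
        = Fin.elim0 := Subsingleton.elim _ _
    rw [hf]
    let τ : Equiv.Perm (Fin n) := (Equiv.sumEmpty (Fin n) (Fin 0)).permCongr σ
    have hτ : (fun a => X (finCongr (Nat.add_zero n) (finSumFinEquiv (σ (Sum.inl a)))))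
        = X ∘ τ := by
      funext a
      simp only [Function.comp, τ, Equiv.permCongr_apply]
      congr 1
      rcases hs : σ (Sum.inl a) with b | b
      · have : (Equiv.sumEmpty (Fin n) (Fin 0)).symm a = Sum.inl a := rfl
        rw [this, hs]
        rfl
      · exact b.elim0
    have hsign : Equiv.Perm.sign τ = Equiv.Perm.sign σ := Equiv.Perm.sign_permCongr _ _
    rw [hτ, AlternatingMap.map_perm, hsign, Units.smul_def, zsmul_eq_mul, ← mul_assoc, ← mul_assoc,
      ← Int.cast_mul, ← Units.val_mul, Int.units_mul_self]
    simp
  rw [Finset.sum_congr rfl fun σ _ => hterm σ]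
  simp only [Finset.sum_const, Finset.card_univ, Fintype.card_perm, Fintype.card_sum,
    Fintype.card_fin, Nat.add_zero, Nat.factorial_zero, Nat.mul_one, nsmul_eq_mul,
    AlternatingMap.smul_apply, smul_eq_mul]
  ring

theorem curryLeft_apply_basis {m : ℕ} (b : Basis (Fin (m + 1)) ℝ V)
    (η : V [⋀^Fin (m + 1)]→ₗ[ℝ] ℝ) (u : V) (τ : Equiv.Perm (Fin (m + 1))) :
    η.curryLeft u (fun i => b (τ i.succ)) =
      ((Equiv.Perm.sign τ : ℤ) : ℝ) * (b.repr u (τ 0) * η b) := by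
  have h1 : ∀ j, η (Fin.cons (b j) fun i => b (τ i.succ) : Fin (m + 1) → V) =
      if j = τ 0 then η (fun i => b (τ i)) else 0 := by
    intro j
    split_ifs with hj
    · congr 1
      ext i
      refine Fin.cases ?_ (fun i => ?_) i <;> simp [hj]
    · obtain ⟨i, rfl⟩ := τ.surjective j
      obtain ⟨i', rfl⟩ := Fin.exists_succ_eq.2 (fun h : i = 0 => hj (by rw [h]))
      exact η.map_eq_zero_of_eq _ (i := 0) (j := i'.succ) (by simp) (Fin.succ_ne_zero _).symm
  have h2 : η.curryLeft u (fun i => b (τ i.succ)) =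
      ∑ j, b.repr u j * η (Fin.cons (b j) fun i => b (τ i.succ) : Fin (m + 1) → V) := by
    let f : V →ₗ[ℝ] ℝ :=
      { toFun := fun u => η.curryLeft u (fun i => b (τ i.succ))
        map_add' := fun x y => by rw [map_add]; rfl
        map_smul' := fun c x => by rw [map_smul]; rfl }
    have hf := map_sum f (fun j => b.repr u j • b j) Finset.univ
    rw [b.sum_repr u] at hf
    simp only [map_smul, smul_eq_mul] at hf
    exact hf
  rw [h2]
  simp only [h1, mul_ite, mul_zero, Finset.sum_ite_eq', Finset.mem_univ, if_true]
  have : (fun i => b (τ i)) = b ∘ τ := rfl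
  rw [this, AlternatingMap.map_perm, Units.smul_def, zsmul_eq_mul]
  ring

theorem one_form_apply_eq_sum {m : ℕ} (b : Basis (Fin (m + 1)) ℝ V) (β : V [⋀^Fin 1]→ₗ[ℝ] ℝ)
    (u : V) : β (fun _ => u) = ∑ j, b.repr u j * β (fun _ => b j) := by
  have := map_sum ((AlternatingMap.ofSubsingleton ℝ V ℝ (0 : Fin 1)).symm β)
    (fun j => b.repr u j • b j) Finset.univ
  rw [b.sum_repr u] at this
  simp only [map_smul, smul_eq_mul] at this
  exact this

/-- `β ∧ ι_u η = β(u) η` for a `1`-form `β` and a form `η` of top degree. -/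
theorem altWedge_curryLeft {m : ℕ} (b : Basis (Fin (m + 1)) ℝ V) (β : V [⋀^Fin 1]→ₗ[ℝ] ℝ)
    (η : V [⋀^Fin (m + 1)]→ₗ[ℝ] ℝ) (u : V) :
    altWedge (Nat.add_comm 1 m) β (η.curryLeft u) = β (fun _ => u) • η := by
  refine Basis.ext_alternating b fun v hv => ?_
  let τ : Equiv.Perm (Fin (m + 1)) := Equiv.ofBijective v (Finite.injective_iff_bijective.1 hv)
  suffices h : altWedge (Nat.add_comm 1 m) β (η.curryLeft u) b = (β (fun _ => u) • η) b by
    have hτ : (fun i => b (v i)) = b ∘ τ := rfl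
    rw [hτ, AlternatingMap.map_perm, AlternatingMap.map_perm, h]
  let e : Fin 1 ⊕ Fin m ≃ Fin (m + 1) := finSumFinEquiv.trans (finCongr (Nat.add_comm 1 m))
  have he0 : e (Sum.inl 0) = 0 := by ext; simp [e]
  have hes : ∀ i, e (Sum.inr i) = i.succ := by intro i; ext; simp [e]
  rw [altWedge_apply, inv_mul_eq_iff_eq_mul₀ (by positivity), AlternatingMap.smul_apply,
    one_form_apply_eq_sum b β u]
  have hterm : ∀ σ : Equiv.Perm (Fin 1 ⊕ Fin m), ((Equiv.Perm.sign σ : ℤ) : ℝ) *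
        (β (fun a => b (finCongr (Nat.add_comm 1 m) (finSumFinEquiv (σ (Sum.inl a))))) *
          η.curryLeft u
            (fun i => b (finCongr (Nat.add_comm 1 m) (finSumFinEquiv (σ (Sum.inr i))))))
        = b.repr u (e.permCongr σ 0) * β (fun _ => b (e.permCongr σ 0)) * η b := by
    intro σ
    have h0 : e.permCongr σ 0 = e (σ (Sum.inl 0)) := by
      rw [Equiv.permCongr_apply, ← he0, Equiv.symm_apply_apply]
    have hs : ∀ i : Fin m, e.permCongr σ i.succ = e (σ (Sum.inr i)) := by
      intro i
      rw [Equiv.permCongr_apply, ← hes, Equiv.symm_apply_apply]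
    have hl : (fun a : Fin 1 => b (finCongr (Nat.add_comm 1 m) (finSumFinEquiv (σ (Sum.inl a)))))
        = fun _ => b (e.permCongr σ 0) := by
      funext a
      rw [h0, Subsingleton.elim a 0]
      rfl
    have hr : (fun i => b (finCongr (Nat.add_comm 1 m) (finSumFinEquiv (σ (Sum.inr i)))))
        = fun i : Fin m => b (e.permCongr σ i.succ) := by
      funext i
      rw [hs]
      rfl
    rw [hl, hr, curryLeft_apply_basis, Equiv.Perm.sign_permCongr]
    have : ((Equiv.Perm.sign σ : ℤ) : ℝ) * ((Equiv.Perm.sign σ : ℤ) : ℝ) = 1 := by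
      rw [← Int.cast_mul, ← Units.val_mul, Int.units_mul_self]
      simp
    linear_combination (β (fun _ => b (e.permCongr σ 0)) * b.repr u (e.permCongr σ 0) * η b) * this
  rw [Finset.sum_congr rfl fun σ _ => hterm σ, ← Finset.sum_mul,
    Equiv.sum_comp e.permCongr (fun τ => b.repr u (τ 0) * β (fun _ => b (τ 0))),
    ← Equiv.sum_comp Equiv.Perm.decomposeFin.symm, Fintype.sum_prod_type]
  simp only [Equiv.Perm.decomposeFin_symm_apply_zero, Finset.sum_const, Finset.card_univ,
    Fintype.card_perm, Fintype.card_fin, Nat.factorial_one, one_mul, nsmul_eq_mul,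
    ← Finset.mul_sum, smul_eq_mul, mul_assoc]

/-- The pairing of `1`-forms and `m`-forms on a space of dimension `m + 1` is nondegenerate. -/
theorem eq_zero_of_altWedge_eq_zero [FiniteDimensional ℝ V] {m : ℕ} (hV : finrank ℝ V = m + 1)
    (γ : V [⋀^Fin m]→ₗ[ℝ] ℝ)
    (h : ∀ β : V [⋀^Fin 1]→ₗ[ℝ] ℝ, altWedge (Nat.add_comm 1 m) β γ = 0) : γ = 0 := by
  ext X
  rw [AlternatingMap.zero_apply]
  have hlt : Submodule.span ℝ (Set.range X) < ⊤ := by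
    rw [lt_top_iff_ne_top]
    intro htop
    have := finrank_range_le_card (R := ℝ) X
    rw [Set.finrank, htop, finrank_top, hV, Fintype.card_fin] at this
    omega
  obtain ⟨f, hf0, hf⟩ := Submodule.exists_le_ker_of_lt_top _ hlt
  obtain ⟨y, hy⟩ : ∃ y, f y ≠ 0 := by
    by_contra! hc
    exact hf0 (LinearMap.ext hc)
  have hfX : ∀ i, f (X i) = 0 := fun i => hf (Submodule.subset_span ⟨i, rfl⟩)
  let β : V [⋀^Fin 1]→ₗ[ℝ] ℝ := AlternatingMap.ofSubsingleton ℝ V ℝ (0 : Fin 1) f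
  let Y : Fin 1 ⊕ Fin m → V := Sum.elim (fun _ => y) X
  have hβ := congrArg (fun η => η (Y ∘ (finSumFinEquiv.trans (finCongr (Nat.add_comm 1 m))).symm))
    (h β)
  have hval : altWedge (Nat.add_comm 1 m) β γ
      (Y ∘ (finSumFinEquiv.trans (finCongr (Nat.add_comm 1 m))).symm) = f y * γ X := by
    have hY : altWedge (Nat.add_comm 1 m) β γ
        (Y ∘ (finSumFinEquiv.trans (finCongr (Nat.add_comm 1 m))).symm) =
        LinearMap.mul' ℝ ℝ (β.domCoprod γ Y) := by
      rw [altWedge, AlternatingMap.domDomCongr_apply, LinearMap.compAlternatingMap_apply]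
      congr 2
      funext i
      simp
    rw [hY, AlternatingMap.domCoprod_apply, _root_.sum_apply, map_sum]
    refine (Finset.sum_eq_single (Quotient.mk'' 1 : Equiv.Perm.ModSumCongr (Fin 1) (Fin m))
      ?_ ?_).trans ?_
    rotate_left 2
    · simp [AlternatingMap.domCoprod.summand_mk'', β, Y]
    · intro q _ hq
      induction q using Quotient.inductionOn' with | _ σ
      rw [AlternatingMap.domCoprod.summand_mk'']
      have hσ : ∃ i, σ (Sum.inl 0) = Sum.inr i := by
        rcases hs : σ (Sum.inl 0) with i | i
        · exfalso
          apply hq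
          refine Quotient.sound' ?_
          rw [QuotientGroup.leftRel_apply]
          have : σ ∈ (Equiv.Perm.sumCongrHom (Fin 1) (Fin m)).range := by
            apply Equiv.Perm.mem_sumCongrHom_range_of_perm_mapsTo_inl
            rintro _ ⟨a, rfl⟩
            rw [Subsingleton.elim a 0, hs]
            exact ⟨i, rfl⟩
          simpa using this
        · exact ⟨i, rfl⟩
      obtain ⟨i, hi⟩ := hσ
      simp [β, Y, hi, hfX]
    · simp
  rw [hval] at hβ
  simpa [hy] using hβ

end Wedge

end LinearAlgebra

section VolumeForm

variable {V : Type*} [NormedAddCommGroup V] [InnerProductSpace ℝ V]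
  {m : ℕ} [Fact (finrank ℝ V = m + 1)] (o : Orientation ℝ V (Fin (m + 1)))

/-- An orthonormal basis defining the orientation `o`. -/
theorem exists_orthonormalBasis_volumeForm_eq :
    ∃ e : OrthonormalBasis (Fin (m + 1)) ℝ V, e.toBasis.orientation = o ∧
      o.volumeForm = e.toBasis.det :=
  ⟨o.finOrthonormalBasis (Nat.succ_pos m) Fact.out,
    o.finOrthonormalBasis_orientation _ _,
    o.volumeForm_robust _ (o.finOrthonormalBasis_orientation _ _)⟩

theorem volumeForm_sq_eq_det_gram (X : Fin (m + 1) → V) :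
    o.volumeForm X ^ 2 = (Matrix.of fun i j => inner ℝ (X i) (X j)).det := by
  obtain ⟨e, -, he⟩ := exists_orthonormalBasis_volumeForm_eq o
  have hG : (Matrix.of fun i j => inner ℝ (X i) (X j)) =
      (e.toBasis.toMatrix X).transpose * e.toBasis.toMatrix X := by
    ext i j
    rw [Matrix.mul_apply, Matrix.of_apply, ← e.sum_inner_mul_inner]
    refine Finset.sum_congr rfl fun k _ => ?_
    rw [Matrix.transpose_apply, Basis.toMatrix_apply, Basis.toMatrix_apply,
      OrthonormalBasis.coe_toBasis_repr_apply, OrthonormalBasis.coe_toBasis_repr_apply,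
      OrthonormalBasis.repr_apply_apply, OrthonormalBasis.repr_apply_apply, real_inner_comm]
  rw [hG, Matrix.det_mul, Matrix.det_transpose, he, Basis.det_apply, sq]

theorem volumeForm_pos_iff (b : Basis (Fin (m + 1)) ℝ V) :
    0 < o.volumeForm b ↔ b.orientation = o := by
  obtain ⟨e, ho, he⟩ := exists_orthonormalBasis_volumeForm_eq o
  rw [he, ← Basis.orientation_eq_iff_det_pos, ho, eq_comm]

theorem volumeForm_basis_ne_zero (b : Basis (Fin (m + 1)) ℝ V) : o.volumeForm b ≠ 0 := by
  obtain ⟨e, -, he⟩ := exists_orthonormalBasis_volumeForm_eq o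
  rw [he]
  exact (e.toBasis.isUnit_det b).ne_zero

theorem altTop_eq_smul_volumeForm (b : Basis (Fin (m + 1)) ℝ V) (μ : V [⋀^Fin (m + 1)]→ₗ[ℝ] ℝ) :
    μ = (μ b / o.volumeForm b) • o.volumeForm := by
  refine Basis.ext_alternating b fun v hv => ?_
  let τ : Equiv.Perm (Fin (m + 1)) := Equiv.ofBijective v (Finite.injective_iff_bijective.1 hv)
  have hτ : (fun i => b (v i)) = b ∘ τ := rfl
  rw [hτ, AlternatingMap.map_perm, AlternatingMap.map_perm, AlternatingMap.smul_apply, smul_eq_mul,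
    div_mul_cancel₀ _ (volumeForm_basis_ne_zero o b)]

theorem det_gram_ne_zero (b : Basis (Fin (m + 1)) ℝ V) :
    (Matrix.of fun i j => inner ℝ (b i) (b j)).det ≠ 0 := by
  rw [← volumeForm_sq_eq_det_gram b.orientation]
  exact pow_ne_zero 2 (volumeForm_basis_ne_zero _ b)

end VolumeForm

section InnerProduct

variable {V : Type*} [NormedAddCommGroup V] [InnerProductSpace ℝ V] [FiniteDimensional ℝ V]

/-- The vector representing a `1`-form with respect to the inner product. -/
noncomputable def altSharp (w : V [⋀^Fin 1]→ₗ[ℝ] ℝ) : V :=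
  (InnerProductSpace.toDual ℝ V).symm (LinearMap.toContinuousLinearMap
    ((AlternatingMap.ofSubsingleton ℝ V ℝ (0 : Fin 1)).symm w))

theorem inner_altSharp (w : V [⋀^Fin 1]→ₗ[ℝ] ℝ) (v : V) :
    inner ℝ (altSharp w) v = w (fun _ => v) := by
  rw [altSharp, InnerProductSpace.toDual_symm_apply]
  rfl

theorem altSharp_add (w w' : V [⋀^Fin 1]→ₗ[ℝ] ℝ) :
    altSharp (w + w') = altSharp w + altSharp w' :=
  ext_inner_right ℝ fun v => by simp [inner_altSharp, inner_add_left]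

theorem altSharp_smul (c : ℝ) (w : V [⋀^Fin 1]→ₗ[ℝ] ℝ) : altSharp (c • w) = c • altSharp w :=
  ext_inner_right ℝ fun v => by simp [inner_altSharp, inner_smul_left]

theorem altHodge_smul {n : ℕ} [Fact (finrank ℝ V = n)] (o : Orientation ℝ V (Fin n)) {k l : ℕ}
    (h : k + l = n) (c : ℝ) (α : V [⋀^Fin k]→ₗ[ℝ] ℝ) :
    altHodge o h (c • α) = c • altHodge o h α := by
  simp only [altHodge, AlternatingMap.smul_apply, Finset.smul_sum, smul_smul, smul_eq_mul]
  exact Finset.sum_congr rfl fun J _ => by congr 1; ring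

variable {m : ℕ} [Fact (finrank ℝ V = m + 1)] (o : Orientation ℝ V (Fin (m + 1)))

theorem sum_volumeForm_stdOrthonormalBasis_sq :
    ∑ J : Fin (m + 1) → Fin (finrank ℝ V),
      o.volumeForm (fun a => stdOrthonormalBasis ℝ V (J a)) ^ 2 = ((m + 1).factorial : ℝ) := by
  have hV : finrank ℝ V = m + 1 := Fact.out
  let e : OrthonormalBasis (Fin (m + 1)) ℝ V :=
    (stdOrthonormalBasis ℝ V).reindex (finCongr hV)
  have hterm : ∀ J : Fin (m + 1) → Fin (m + 1), o.volumeForm (fun a => e (J a)) ^ 2 =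
      if Function.Bijective J then 1 else 0 := by
    intro J
    split_ifs with hJ
    · have h1 : (fun a => e (J a)) = e ∘ Equiv.ofBijective J hJ := rfl
      have h2 := o.abs_volumeForm_apply_of_orthonormal (e.reindex (Equiv.ofBijective J hJ).symm)
      rw [← sq_abs]
      have h3 : (fun a => e (J a)) = e.reindex (Equiv.ofBijective J hJ).symm := by
        rw [OrthonormalBasis.coe_reindex e, h1]
        rfl
      rw [h3, h2, one_pow]
    · rw [← Finite.injective_iff_bijective] at hJ
      rw [Function.Injective] at hJ
      push Not at hJ
      obtain ⟨a, b, hab, hne⟩ := hJ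
      rw [o.volumeForm.map_eq_zero_of_eq _ (i := a) (j := b) (by rw [hab]) hne]
      simp
  have hre : ∑ J : Fin (m + 1) → Fin (finrank ℝ V),
      o.volumeForm (fun a => stdOrthonormalBasis ℝ V (J a)) ^ 2 =
      ∑ J : Fin (m + 1) → Fin (m + 1), o.volumeForm (fun a => e (J a)) ^ 2 := by
    refine Fintype.sum_equiv (Equiv.arrowCongr (Equiv.refl _) (finCongr hV)) _ _ fun J => ?_
    simp [e, Equiv.arrowCongr]
  classical
  rw [hre, Finset.sum_congr rfl fun J _ => hterm J, Finset.sum_boole]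
  have hcard : Fintype.card {J : Fin (m + 1) → Fin (m + 1) // Function.Bijective J} =
      (m + 1).factorial := by
    rw [← Fintype.card_congr (Equiv.ofBijective
      (fun σ : Equiv.Perm (Fin (m + 1)) =>
        (⟨σ, σ.bijective⟩ : {J : Fin (m + 1) → Fin (m + 1) // Function.Bijective J}))
      ⟨fun σ τ h => Equiv.ext fun i => congrFun (congrArg Subtype.val h) i,
        fun J => ⟨Equiv.ofBijective J.1 J.2, rfl⟩⟩), Fintype.card_perm, Fintype.card_fin]
  rw [← hcard, Fintype.card_subtype]

/-- `(*μ) vol = μ`. -/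
theorem altHodge_top_smul_volumeForm (μ : V [⋀^Fin (m + 1)]→ₗ[ℝ] ℝ) :
    altHodge o (Nat.add_zero (m + 1)) μ Fin.elim0 • o.volumeForm = μ := by
  obtain ⟨e, -, -⟩ := exists_orthonormalBasis_volumeForm_eq o
  obtain ⟨c, hc⟩ : ∃ c : ℝ, μ = c • o.volumeForm := ⟨_, altTop_eq_smul_volumeForm o e.toBasis μ⟩
  suffices h : altHodge o (Nat.add_zero (m + 1)) o.volumeForm Fin.elim0 = 1 by
    rw [hc, altHodge_smul, AlternatingMap.smul_apply, h, smul_eq_mul, mul_one]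
  have hins : ∀ u : Fin (m + 1) → V,
      altInsert (Nat.add_zero (m + 1)) o.volumeForm u Fin.elim0 = o.volumeForm u := by
    intro u
    change o.volumeForm.domDomCongr (finCongr (Nat.add_zero (m + 1)).symm)
      (Fin.append u Fin.elim0) = _
    rw [AlternatingMap.domDomCongr_apply]
    congr 1
    funext i
    exact Fin.append_left u Fin.elim0 i
  let ev : (V [⋀^Fin 0]→ₗ[ℝ] ℝ) →ₗ[ℝ] ℝ :=
    { toFun := fun f => f Fin.elim0, map_add' := fun _ _ => rfl, map_smul' := fun _ _ => rfl }
  change ev (altHodge o (Nat.add_zero (m + 1)) o.volumeForm) = 1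
  rw [altHodge, map_smul, map_sum]
  simp only [map_smul, smul_eq_mul]
  have hsum := sum_volumeForm_stdOrthonormalBasis_sq o
  rw [inv_mul_eq_iff_eq_mul₀ (by positivity), mul_one, ← hsum]
  refine Finset.sum_congr rfl fun J _ => ?_
  change _ * altInsert (Nat.add_zero (m + 1)) o.volumeForm _ Fin.elim0 = _
  rw [hins, sq]

/-- The Hodge star of a `1`-form `w` is `ι_v vol`, where `w = ⟨v, ·⟩`. -/
theorem altHodge_one_form (w : V [⋀^Fin 1]→ₗ[ℝ] ℝ) :
    altHodge o (Nat.add_comm 1 m) w = o.volumeForm.curryLeft (altSharp w) := by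
  have hins : ∀ u : V, altInsert (Nat.add_comm 1 m) o.volumeForm (fun _ => u) =
      o.volumeForm.curryLeft u := by
    intro u
    ext X
    change o.volumeForm.domDomCongr (finCongr (Nat.add_comm 1 m).symm)
      (Fin.append (fun _ => u) X) = o.volumeForm (Fin.cons u X : Fin (m + 1) → V)
    rw [AlternatingMap.domDomCongr_apply]
    congr 1
    funext i
    refine Fin.cases ?_ (fun i => ?_) i
    · exact Fin.append_left (fun _ => u) X (0 : Fin 1)
    · rw [Fin.cons_succ]
      have : (finCongr (Nat.add_comm 1 m).symm) i.succ = Fin.natAdd 1 i := by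
        ext; simp [Nat.add_comm]
      rw [Function.comp_apply, this, Fin.append_right]
  rw [altHodge, Nat.factorial_one, Nat.cast_one, inv_one, one_smul]
  rw [← Equiv.sum_comp (Equiv.funUnique (Fin 1) (Fin (finrank ℝ V))).symm]
  have hsharp : altSharp w =
      ∑ j, w (fun _ => stdOrthonormalBasis ℝ V j) • stdOrthonormalBasis ℝ V j := by
    rw [← (stdOrthonormalBasis ℝ V).sum_repr (altSharp w)]
    refine Finset.sum_congr rfl fun j _ => ?_
    rw [OrthonormalBasis.repr_apply_apply, real_inner_comm, inner_altSharp]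
  rw [hsharp, map_sum]
  refine Finset.sum_congr rfl fun j _ => ?_
  rw [map_smul, ← hins]
  rfl

/-- `β ∧ *w = β(v) vol`, where `w = ⟨v, ·⟩`. -/
theorem altWedge_altHodge (β w : V [⋀^Fin 1]→ₗ[ℝ] ℝ) :
    altWedge (Nat.add_comm 1 m) β (altHodge o (Nat.add_comm 1 m) w) =
      β (fun _ => altSharp w) • o.volumeForm := by
  obtain ⟨e, -, -⟩ := exists_orthonormalBasis_volumeForm_eq o
  rw [altHodge_one_form, altWedge_curryLeft e.toBasis]

/-- The coordinates of the vector representing a `1`-form: raising the index by the inverse of the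
Gram matrix. -/
theorem altSharp_eq_sum (b : Basis (Fin (m + 1)) ℝ V) (w : V [⋀^Fin 1]→ₗ[ℝ] ℝ) :
    altSharp w = ∑ i, (∑ j, (Matrix.of fun i j => inner ℝ (b i) (b j))⁻¹ i j *
      w (fun _ => b j)) • b i := by
  refine ext_inner_right ℝ fun v => LinearMap.congr_fun (f := innerₗ V _) (g := innerₗ V _)
    (b.ext fun k => ?_) v
  set G : Matrix (Fin (m + 1)) (Fin (m + 1)) ℝ := Matrix.of fun i j => inner ℝ (b i) (b j) with hG
  have hmul : G.mulVec (G⁻¹.mulVec fun j => w fun _ => b j) = fun j => w fun _ => b j := by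
    rw [Matrix.mulVec_mulVec, Matrix.mul_nonsing_inv _ (det_gram_ne_zero b).isUnit,
      Matrix.one_mulVec]
  rw [innerₗ_apply_apply, innerₗ_apply_apply, inner_altSharp, real_inner_comm, inner_sum]
  refine (congrFun hmul k).symm.trans ?_
  rw [Matrix.mulVec, dotProduct]
  refine Finset.sum_congr rfl fun i _ => ?_
  rw [inner_smul_right, mul_comm]
  rfl

/-- The `1`-form `X ↦ *(⟨X, ·⟩ ∧ γ)` attached to an `m`-form `γ`. -/
noncomputable def altCohodge (γ : V [⋀^Fin m]→ₗ[ℝ] ℝ) : V [⋀^Fin 1]→ₗ[ℝ] ℝ :=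
  AlternatingMap.ofSubsingleton ℝ V ℝ (0 : Fin 1)
    { toFun := fun X => altHodge o (Nat.add_zero (m + 1)) (altWedge (Nat.add_comm 1 m)
        (AlternatingMap.ofSubsingleton ℝ V ℝ (0 : Fin 1) (innerₗ V X)) γ) Fin.elim0
      map_add' := fun X Y => by
        have hadd : ∀ μ μ' : V [⋀^Fin (m + 1)]→ₗ[ℝ] ℝ,
            altHodge o (Nat.add_zero (m + 1)) (μ + μ') Fin.elim0 =
            altHodge o (Nat.add_zero (m + 1)) μ Fin.elim0 +
              altHodge o (Nat.add_zero (m + 1)) μ' Fin.elim0 := by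
          intro μ μ'
          simp only [altHodge, AlternatingMap.add_apply, add_smul, Finset.sum_add_distrib, smul_add]
        rw [← hadd, ← altWedge_add_left]
        congr 3
        ext v
        simp
      map_smul' := fun c X => by
        rw [RingHom.id_apply, smul_eq_mul, ← smul_eq_mul, ← AlternatingMap.smul_apply,
          ← altHodge_smul, ← altWedge_smul_left]
        congr 3
        ext v
        simp }

theorem altCohodge_apply_smul_volumeForm (γ : V [⋀^Fin m]→ₗ[ℝ] ℝ) (X : V) :
    altCohodge o γ (fun _ => X) • o.volumeForm = altWedge (Nat.add_comm 1 m)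
      (AlternatingMap.ofSubsingleton ℝ V ℝ (0 : Fin 1) (innerₗ V X)) γ :=
  altHodge_top_smul_volumeForm o _

theorem altWedge_altCohodge (γ : V [⋀^Fin m]→ₗ[ℝ] ℝ) :
    altWedge (Nat.add_comm 1 m) (altCohodge o γ) γ =
      ‖altSharp (altCohodge o γ)‖ ^ 2 • o.volumeForm := by
  have h : altCohodge o γ =
      AlternatingMap.ofSubsingleton ℝ V ℝ (0 : Fin 1) (innerₗ V (altSharp (altCohodge o γ))) := by
    ext X
    have hX : X = fun _ => X 0 := by
      funext i
      rw [Subsingleton.elim i 0]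
    rw [hX, ← inner_altSharp]
    rfl
  conv_lhs => rw [h]
  rw [← altCohodge_apply_smul_volumeForm, ← inner_altSharp, real_inner_self_eq_norm_sq]

theorem eq_zero_of_altSharp_altCohodge_eq_zero (γ : V [⋀^Fin m]→ₗ[ℝ] ℝ)
    (h : altSharp (altCohodge o γ) = 0) : γ = 0 := by
  refine eq_zero_of_altWedge_eq_zero (Fact.out : finrank ℝ V = m + 1) γ fun β => ?_
  have hβ : β = AlternatingMap.ofSubsingleton ℝ V ℝ (0 : Fin 1) (innerₗ V (altSharp β)) := by
    ext X
    have hX : X = fun _ => X 0 := by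
      funext i
      rw [Subsingleton.elim i 0]
    rw [hX, ← inner_altSharp]
    rfl
  rw [hβ, ← altCohodge_apply_smul_volumeForm, ← inner_altSharp, h, inner_zero_left, zero_smul]

end InnerProduct

section Smoothness

variable {m : ℕ} {H : Type*} [TopologicalSpace H]
  {I : ModelWithCorners ℝ (EuclideanSpace ℝ (Fin (m + 1))) H}
  {M : Type*} [TopologicalSpace M] [ChartedSpace H M]

theorem contMDiffOn_det {ι : Type*} [Fintype ι] [DecidableEq ι] {A : M → Matrix ι ι ℝ} {s : Set M}
    (hA : ∀ i j, ContMDiffOn I 𝓘(ℝ) ∞ (fun x => A x i j) s) :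
    ContMDiffOn I 𝓘(ℝ) ∞ (fun x => (A x).det) s := by
  simp only [Matrix.det_apply']
  exact contMDiffOn_finsetSum fun σ _ =>
    contMDiffOn_const.mul (contMDiffOn_finsetProd fun i _ => hA _ _)

theorem contMDiffOn_matrix_inv {ι : Type*} [Fintype ι] [DecidableEq ι] {A : M → Matrix ι ι ℝ}
    {s : Set M} (hA : ∀ i j, ContMDiffOn I 𝓘(ℝ) ∞ (fun x => A x i j) s)
    (hdet : ∀ x ∈ s, (A x).det ≠ 0) (i j : ι) :
    ContMDiffOn I 𝓘(ℝ) ∞ (fun x => (A x)⁻¹ i j) s := by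
  have h : ∀ x, (A x)⁻¹ i j = ((A x).det)⁻¹ * ((A x).updateRow j (Pi.single i 1)).det := by
    intro x
    rw [Matrix.inv_def, Ring.inverse_eq_inv', Matrix.smul_apply, Matrix.adjugate_apply, smul_eq_mul]
  simp only [h]
  refine ((contMDiffOn_det hA).inv₀ hdet).mul (contMDiffOn_det fun k l => ?_)
  by_cases hk : k = j
  · subst hk
    simp only [Matrix.updateRow_self]
    exact contMDiffOn_const
  · simp only [Matrix.updateRow_ne hk]
    exact hA k l

theorem contMDiff_of_contMDiffOn_chart_source {f : M → ℝ}
    (hf : ∀ c : M, ContMDiffOn I 𝓘(ℝ) ∞ f (chartAt H c).source) : ContMDiff I 𝓘(ℝ) ∞ f :=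
  fun x => (hf x).contMDiffAt ((chartAt H x).open_source.mem_nhds (mem_chart_source H x))

theorem interiorProduct_one_form_apply (v : ∀ x : M, TangentSpace I x) (w : DForm I M 1) (x : M)
    (X : Fin 0 → TangentSpace I x) : interiorProduct v w x X = w x (fun _ => v x) := by
  change w x (Fin.cons _ _ : Fin 1 → _) = _
  congr 1
  funext a
  exact Fin.cases rfl (fun b => b.elim0) a

variable [IsManifold I ∞ M]

variable (I) in
/-- The coordinate frame of a chart, as a basis of the tangent space. -/
theorem exists_basis_eq_coordFrame {c x : M} (hx : x ∈ (chartAt H c).source) :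
    ∃ b : Basis (Fin (m + 1)) ℝ (TangentSpace I x), ⇑b = coordFrame I c x := by
  let e := trivializationAt (EuclideanSpace ℝ (Fin (m + 1))) (TangentSpace I : M → Type _) c
  have hx' : x ∈ e.baseSet := hx
  refine ⟨(EuclideanSpace.basisFun (Fin (m + 1)) ℝ).toBasis.map
    (e.continuousLinearEquivAt ℝ x hx').symm.toLinearEquiv, ?_⟩
  funext j
  rw [Basis.map_apply]
  refine (congrFun (e.symm_continuousLinearEquivAt_eq hx') _).trans ?_
  rw [OrthonormalBasis.coe_toBasis]
  rfl

theorem IsSmoothForm.add {k : ℕ} {η θ : DForm I M k} (hη : IsSmoothForm η) (hθ : IsSmoothForm θ) :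
    IsSmoothForm (η + θ) :=
  fun c J => (hη c J).add (hθ c J)

theorem IsSmoothForm.sub {k : ℕ} {η θ : DForm I M k} (hη : IsSmoothForm η) (hθ : IsSmoothForm θ) :
    IsSmoothForm (η - θ) :=
  fun c J => (hη c J).sub (hθ c J)

theorem IsSmoothForm.fmul {k : ℕ} {f : M → ℝ} {η : DForm I M k} (hf : ContMDiff I 𝓘(ℝ) ∞ f)
    (hη : IsSmoothForm η) : IsSmoothForm (fmul f η) :=
  fun c J => hf.contMDiffOn.mul (hη c J)

theorem IsSmoothForm.const_smul {k : ℕ} {η : DForm I M k} (hη : IsSmoothForm η) (r : ℝ) :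
    IsSmoothForm (r • η) :=
  hη.fmul (contMDiff_const (c := r))

theorem IsSmoothForm.wedge {k l p : ℕ} (h : k + l = p) {η : DForm I M k} {θ : DForm I M l}
    (hη : IsSmoothForm η) (hθ : IsSmoothForm θ) : IsSmoothForm (wedge h η θ) := by
  intro c J
  simp only [_root_.wedge, altWedge_apply]
  exact contMDiffOn_const.mul (contMDiffOn_finsetSum fun σ _ => contMDiffOn_const.mul
    ((hη c _).mul (hθ c _)))

/-- A form of top degree is smooth if its values on the coordinate frames are. -/
theorem isSmoothForm_of_top {η : DForm I M (m + 1)}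
    (h : ∀ c : M, ContMDiffOn I 𝓘(ℝ) ∞ (fun x => η x (coordFrame I c x)) (chartAt H c).source) :
    IsSmoothForm η := by
  intro c J
  by_cases hJ : Function.Injective J
  · let τ : Equiv.Perm (Fin (m + 1)) := Equiv.ofBijective J (Finite.injective_iff_bijective.1 hJ)
    have hτ : ∀ x, η x (fun a => coordFrame I c x (J a)) =
        ((Equiv.Perm.sign τ : ℤ) : ℝ) * η x (coordFrame I c x) := by
      intro x
      have : (fun a => coordFrame I c x (J a)) = coordFrame I c x ∘ τ := rfl
      rw [this, AlternatingMap.map_perm, Units.smul_def, zsmul_eq_mul]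
    simp only [hτ]
    exact contMDiffOn_const.mul (h c)
  · rw [Function.Injective] at hJ
    push Not at hJ
    obtain ⟨a, b, hab, hne⟩ := hJ
    have h0 : ∀ x, η x (fun a => coordFrame I c x (J a)) = 0 := fun x =>
      (η x).map_eq_zero_of_eq _ (i := a) (j := b) (by rw [hab]) hne
    simp only [h0]
    exact contMDiffOn_const

theorem eventually_chartSign_eq (o : ManifoldOrientation I M) {c x : M}
    (hx : x ∈ (chartAt H c).source) : ∀ᶠ y in 𝓝 x, chartSign o c y = chartSign o c x := by
  filter_upwards [o.locally_constant c x hx] with y hy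
  unfold chartSign
  by_cases h : IsPositiveFrame (o.at' x) (coordFrame I c x)
  · rw [if_pos h, if_pos (hy.2 h)]
  · rw [if_neg h, if_neg fun h' => h (hy.1 h')]

theorem contMDiffOn_chartSign (o : ManifoldOrientation I M) (c : M) :
    ContMDiffOn I 𝓘(ℝ) ∞ (chartSign o c) (chartAt H c).source :=
  fun x hx => (contMDiffAt_const (c := chartSign o c x)).congr_of_eventuallyEq
    (eventually_chartSign_eq o hx) |>.contMDiffWithinAt

theorem chartSign_mul_self (o : ManifoldOrientation I M) (c x : M) :
    chartSign o c x * chartSign o c x = 1 := by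
  unfold chartSign
  split_ifs <;> norm_num

variable [RiemannianBundle (fun x : M => TangentSpace I x)]

/-- The Riemannian volume form. -/
noncomputable def volForm (o : ManifoldOrientation I M) : DForm I M (m + 1) :=
  fun x => (o.at' x).volumeForm

theorem volForm_coordFrame_ne_zero (o : ManifoldOrientation I M) {c x : M}
    (hx : x ∈ (chartAt H c).source) : volForm o x (coordFrame I c x) ≠ 0 := by
  obtain ⟨b, hb⟩ := exists_basis_eq_coordFrame I hx
  rw [← hb]
  exact volumeForm_basis_ne_zero (o.at' x) b

theorem chartSign_mul_volForm_pos (o : ManifoldOrientation I M) {c x : M}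
    (hx : x ∈ (chartAt H c).source) :
    0 < chartSign o c x * volForm o x (coordFrame I c x) := by
  obtain ⟨b, hb⟩ := exists_basis_eq_coordFrame I hx
  have hne := volForm_coordFrame_ne_zero o hx
  have hpos : 0 < volForm o x (coordFrame I c x) ↔ b.orientation = o.at' x := by
    rw [← hb]
    exact volumeForm_pos_iff (o.at' x) b
  unfold chartSign
  split_ifs with h
  · obtain ⟨b', hb', ho⟩ := h
    have hbb : b' = b := Basis.eq_of_apply_eq fun i => by rw [hb', hb]
    rw [one_mul]
    exact hpos.2 (hbb ▸ ho)
  · have : ¬ 0 < volForm o x (coordFrame I c x) := fun hp =>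
      h ⟨b, fun j => congrFun hb j, hpos.1 hp⟩
    have hlt := lt_of_le_of_ne (not_lt.1 this) hne
    linarith

theorem density_smul_volForm (o : ManifoldOrientation I M) (μ : DForm I M (m + 1)) (x : M) :
    density o μ x • volForm o x = μ x :=
  altHodge_top_smul_volumeForm (o.at' x) (μ x)

theorem density_eq_div (o : ManifoldOrientation I M) (μ : DForm I M (m + 1)) {c x : M}
    (hx : x ∈ (chartAt H c).source) :
    density o μ x = μ x (coordFrame I c x) / volForm o x (coordFrame I c x) := by
  rw [eq_div_iff (volForm_coordFrame_ne_zero o hx)]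
  exact congrArg (fun η => η (coordFrame I c x)) (density_smul_volForm o μ x)

/-- `(*μ) β ∧ *w = β(v) μ`, where `w = ⟨v, ·⟩`. -/
theorem density_smul_wedge_hodge (o : ManifoldOrientation I M) (β w : DForm I M 1)
    (μ : DForm I M (m + 1)) :
    fmul (density o μ) (wedge (Nat.add_comm 1 m) β (hodge o (Nat.add_comm 1 m) w)) =
      fmul (fun x => β x (fun _ => sharp w x)) μ := by
  funext x
  have h : wedge (Nat.add_comm 1 m) β (hodge o (Nat.add_comm 1 m) w) x =
      β x (fun _ => sharp w x) • volForm o x := altWedge_altHodge (o.at' x) (β x) (w x)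
  rw [fmul, fmul, h, smul_comm, density_smul_volForm]

/-- `(*μ) *w = ι_v μ`, where `w = ⟨v, ·⟩`. -/
theorem density_smul_hodge (o : ManifoldOrientation I M) (w : DForm I M 1)
    (μ : DForm I M (m + 1)) :
    fmul (density o μ) (hodge o (Nat.add_comm 1 m) w) = interiorProduct (sharp w) μ := by
  funext x
  have h : hodge o (Nat.add_comm 1 m) w x = (volForm o x).curryLeft (sharp w x) :=
    altHodge_one_form (o.at' x) (w x)
  have h2 : interiorProduct (sharp w) μ x =
      (density o μ x • volForm o x).curryLeft (sharp w x) := by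
    rw [density_smul_volForm]
    rfl
  rw [h2, fmul, h]
  rfl

variable [IsContMDiffRiemannianBundle I ∞ (EuclideanSpace ℝ (Fin (m + 1)))
      (fun x : M => TangentSpace I x)]

theorem contMDiffOn_inner_coordFrame (c : M) (i j : Fin (m + 1)) :
    ContMDiffOn I 𝓘(ℝ) ∞ (fun x => (inner ℝ (coordFrame I c x i) (coordFrame I c x j) : ℝ))
      (chartAt H c).source := by
  let e := trivializationAt (EuclideanSpace ℝ (Fin (m + 1))) (TangentSpace I : M → Type _) c
  have hs : ∀ j : Fin (m + 1), ContMDiffOn I (I.prod 𝓘(ℝ, EuclideanSpace ℝ (Fin (m + 1)))) ∞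
      (fun x => (TotalSpace.mk' (EuclideanSpace ℝ (Fin (m + 1))) x (coordFrame I c x j) :
        TotalSpace (EuclideanSpace ℝ (Fin (m + 1))) (TangentSpace I : M → Type _)))
      (chartAt H c).source := by
    intro j
    refine (e.contMDiffOn_section_baseSet_iff (IB := I) (n := ∞)).2 ?_
    refine (contMDiffOn_const (c := EuclideanSpace.basisFun (Fin (m + 1)) ℝ j)).congr ?_
    intro y hy
    have := e.continuousLinearMapAt_symmL (R := ℝ) hy (EuclideanSpace.basisFun (Fin (m + 1)) ℝ j)
    rw [← this, ← e.coe_continuousLinearEquivAt_eq hy]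
    rfl
  exact ContMDiffOn.inner_bundle (hs i) (hs j)

/-- The Gram matrix of the coordinate frame. -/
noncomputable def metricMatrix (I : ModelWithCorners ℝ (EuclideanSpace ℝ (Fin (m + 1))) H)
    [IsManifold I ∞ M] [RiemannianBundle (fun x : M => TangentSpace I x)] (c x : M) :
    Matrix (Fin (m + 1)) (Fin (m + 1)) ℝ :=
  Matrix.of fun i j => inner ℝ (coordFrame I c x i) (coordFrame I c x j)

theorem isSmoothForm_volForm (o : ManifoldOrientation I M) : IsSmoothForm (volForm o) := by
  refine isSmoothForm_of_top fun c => ?_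
  have hdet : ContMDiffOn I 𝓘(ℝ) ∞ (fun x => (metricMatrix I c x).det) (chartAt H c).source :=
    contMDiffOn_det fun i j => contMDiffOn_inner_coordFrame c i j
  have hsq : ∀ x, volForm o x (coordFrame I c x) ^ 2 = (metricMatrix I c x).det := fun x =>
    volumeForm_sq_eq_det_gram (o.at' x) (coordFrame I c x)
  have hsqrt : ContMDiffOn I 𝓘(ℝ) ∞ (fun x => √(metricMatrix I c x).det) (chartAt H c).source := by
    intro x hx
    have hne : (metricMatrix I c x).det ≠ 0 := by
      rw [← hsq]
      exact pow_ne_zero 2 (volForm_coordFrame_ne_zero o hx)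
    exact (Real.contDiffAt_sqrt hne).contMDiffAt.comp_contMDiffWithinAt x (hdet x hx)
  refine ((contMDiffOn_chartSign o c).mul hsqrt).congr fun x hx => ?_
  have hpos := chartSign_mul_volForm_pos o hx
  have hval : √(metricMatrix I c x).det = chartSign o c x * volForm o x (coordFrame I c x) := by
    rw [Real.sqrt_eq_iff_mul_self_eq_of_pos hpos, ← sq, mul_pow, hsq, sq, chartSign_mul_self,
      one_mul]
  rw [Pi.mul_apply, hval, ← mul_assoc, chartSign_mul_self, one_mul]

theorem contMDiff_density (o : ManifoldOrientation I M) {μ : DForm I M (m + 1)}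
    (hμ : IsSmoothForm μ) : ContMDiff I 𝓘(ℝ) ∞ (density o μ) := by
  refine contMDiff_of_contMDiffOn_chart_source fun c => ?_
  exact ((hμ c id).div₀ (isSmoothForm_volForm o c id)
    fun x hx => volForm_coordFrame_ne_zero o hx).congr fun x hx => density_eq_div o μ hx

/-- The components of the vector field `v` with `w = ⟨v, ·⟩` are smooth. -/
theorem exists_sharp_eq_sum {w : DForm I M 1} (hw : IsSmoothForm w) (c : M) :
    ∃ v : Fin (m + 1) → M → ℝ, (∀ i, ContMDiffOn I 𝓘(ℝ) ∞ (v i) (chartAt H c).source) ∧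
      ∀ x ∈ (chartAt H c).source, sharp w x = ∑ i, v i x • coordFrame I c x i := by
  refine ⟨fun i x => ∑ j, (metricMatrix I c x)⁻¹ i j * w x (fun _ => coordFrame I c x j), ?_, ?_⟩
  · intro i
    refine contMDiffOn_finsetSum fun j _ => (contMDiffOn_matrix_inv
      (fun i j => contMDiffOn_inner_coordFrame c i j) (fun x hx => ?_) i j).mul (hw c fun _ => j)
    obtain ⟨b, hb⟩ := exists_basis_eq_coordFrame I hx
    have := det_gram_ne_zero b
    rw [hb] at this
    exact this
  · intro x hx
    obtain ⟨b, hb⟩ := exists_basis_eq_coordFrame I hx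
    have := altSharp_eq_sum b (w x)
    rw [hb] at this
    exact this

theorem isSmoothForm_interiorProduct_sharp {k : ℕ} {w : DForm I M 1} {η : DForm I M (k + 1)}
    (hw : IsSmoothForm w) (hη : IsSmoothForm η) : IsSmoothForm (interiorProduct (sharp w) η) := by
  intro c J
  obtain ⟨v, hv, hsum⟩ := exists_sharp_eq_sum hw c
  have h : ContMDiffOn I 𝓘(ℝ) ∞ (fun x => ∑ i, v i x *
      η x (fun a => coordFrame I c x ((Fin.cons i J : Fin (k + 1) → Fin (m + 1)) a)))
      (chartAt H c).source :=
    contMDiffOn_finsetSum fun i _ => (hv i).mul (hη c _)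
  refine h.congr fun x hx => ?_
  let f : TangentSpace I x →ₗ[ℝ] ℝ :=
    { toFun := fun u => (η x).curryLeft u (fun a => coordFrame I c x (J a))
      map_add' := fun y z => by rw [map_add]; rfl
      map_smul' := fun r y => by rw [map_smul]; rfl }
  change f (sharp w x) = _
  rw [hsum x hx, map_sum]
  refine Finset.sum_congr rfl fun i _ => ?_
  rw [map_smul, smul_eq_mul]
  congr 1
  change η x (Fin.cons _ _ : Fin (k + 1) → _) = _
  congr 1
  funext a
  refine Fin.cases ?_ (fun a => ?_) a <;> simp

theorem contMDiff_one_form_sharp {β w : DForm I M 1} (hβ : IsSmoothForm β) (hw : IsSmoothForm w) :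
    ContMDiff I 𝓘(ℝ) ∞ (fun x => β x (fun _ => sharp w x)) := by
  refine contMDiff_of_contMDiffOn_chart_source fun c => ?_
  refine (isSmoothForm_interiorProduct_sharp hw hβ c Fin.elim0).congr fun x _ => ?_
  exact (interiorProduct_one_form_apply (sharp w) β x _).symm

/-- The `1`-form `X ↦ *(⟨X, ·⟩ ∧ γ)` attached to an `m`-form `γ`. -/
noncomputable def cohodge (o : ManifoldOrientation I M) (γ : DForm I M m) : DForm I M 1 :=
  fun x => altCohodge (o.at' x) (γ x)

theorem isSmoothForm_cohodge (o : ManifoldOrientation I M) {γ : DForm I M m}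
    (hγ : IsSmoothForm γ) : IsSmoothForm (cohodge o γ) := by
  intro c J
  have hvol : ContMDiffOn I 𝓘(ℝ) ∞ (fun x => volForm o x (coordFrame I c x))
    (chartAt H c).source := isSmoothForm_volForm o c id
  have hnum : ContMDiffOn I 𝓘(ℝ) ∞ (fun x => altWedge (Nat.add_comm 1 m)
      (AlternatingMap.ofSubsingleton ℝ (TangentSpace I x) ℝ (0 : Fin 1)
        (innerₗ (TangentSpace I x) (coordFrame I c x (J 0)))) (γ x) (coordFrame I c x))
      (chartAt H c).source := by
    simp only [altWedge_apply]
    exact contMDiffOn_const.mul (contMDiffOn_finsetSum fun σ _ => contMDiffOn_const.mul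
      ((contMDiffOn_inner_coordFrame c _ _).mul (hγ c _)))
  refine (hnum.div₀ hvol fun x hx => volForm_coordFrame_ne_zero o hx).congr fun x hx => ?_
  rw [Pi.div_apply, eq_div_iff (volForm_coordFrame_ne_zero o hx)]
  have hJ : (fun a => coordFrame I c x (J a)) = fun _ => coordFrame I c x (J 0) := by
    funext a
    rw [Subsingleton.elim a 0]
  rw [hJ]
  exact congrArg (fun η => η (coordFrame I c x))
    (altCohodge_apply_smul_volumeForm (o.at' x) (γ x) (coordFrame I c x (J 0)))

end Smoothness

section Integration

variable {m : ℕ} {H : Type*} [TopologicalSpace H]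
  {I : ModelWithCorners ℝ (EuclideanSpace ℝ (Fin (m + 1))) H}
  {M : Type*} [TopologicalSpace M] [ChartedSpace H M]

theorem measurableSet_extChartAt_target (c : M) : MeasurableSet (extChartAt I c).target := by
  rw [extChartAt_target]
  exact ((chartAt H c).open_target.preimage I.continuous_symm).measurableSet.inter
    I.isClosed_range.measurableSet

theorem extChartAt_target_subset_closure_interior_self (c : M) :
    (extChartAt I c).target ⊆ closure (interior (extChartAt I c).target) := by
  intro y hy
  rw [extChartAt_target] at hy ⊢
  have hO : IsOpen (I.symm ⁻¹' (chartAt H c).target) :=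
    (chartAt H c).open_target.preimage I.continuous_symm
  rw [interior_inter, hO.interior_eq]
  exact hO.inter_closure ⟨hy.1, I.range_subset_closure_interior hy.2⟩

variable [IsManifold I ∞ M] [T2Space M] [CompactSpace M]

theorem chartPartition_tsupport_subset (c : M) :
    tsupport (chartPartition I M c) ⊆ (chartAt H c).source :=
  (SmoothPartitionOfUnity.exists_isSubordinate_chartAt_source I M).choose_spec c

theorem finite_support_chartPartition :
    {c : M | (Function.support (chartPartition I M c)).Nonempty}.Finite :=
  (chartPartition I M).locallyFinite.finite_nonempty_of_compact

/-- The contribution of the chart around `c` to the integral of a form, before composition with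
the inverse of the chart. -/
noncomputable def chartIntegrand (o : ManifoldOrientation I M) (η : DForm I M (m + 1)) (c x : M) :
    ℝ :=
  chartSign o c x * chartPartition I M c x * η x (coordFrame I c x)

theorem integralForm_eq_finsum (o : ManifoldOrientation I M) (η : DForm I M (m + 1)) :
    integralForm o η = ∑ᶠ c : M, ∫ y in (extChartAt I c).target,
      chartIntegrand o η c ((extChartAt I c).symm y) := rfl

theorem support_integral_chartIntegrand_subset (o : ManifoldOrientation I M)
    (η : DForm I M (m + 1)) :
    Function.support (fun c : M => ∫ y in (extChartAt I c).target,
      chartIntegrand o η c ((extChartAt I c).symm y)) ⊆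
      {c : M | (Function.support (chartPartition I M c)).Nonempty} := by
  intro c hc
  by_contra hne
  have h0 : ∀ x, chartPartition I M c x = 0 := by
    intro x
    by_contra hx
    exact hne ⟨x, hx⟩
  exact hc (by simp [chartIntegrand, h0])

theorem continuousOn_chartIntegrand (o : ManifoldOrientation I M) {η : DForm I M (m + 1)}
    (hη : IsSmoothForm η) (c : M) :
    ContinuousOn (fun y => chartIntegrand o η c ((extChartAt I c).symm y))
      (extChartAt I c).target := by
  have h : ContinuousOn (chartIntegrand o η c) (chartAt H c).source :=
    ((contMDiffOn_chartSign o c).continuousOn.mul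
      (chartPartition I M c).contMDiff.continuous.continuousOn).mul (hη c id).continuousOn
  refine h.comp (continuousOn_extChartAt_symm c) fun y hy => ?_
  rw [← extChartAt_source I]
  exact (extChartAt I c).map_target hy

theorem integrableOn_chartIntegrand (o : ManifoldOrientation I M) {η : DForm I M (m + 1)}
    (hη : IsSmoothForm η) (c : M) :
    IntegrableOn (fun y => chartIntegrand o η c ((extChartAt I c).symm y))
      (extChartAt I c).target := by
  have hsub : tsupport (chartPartition I M c) ⊆ (extChartAt I c).source := by
    rw [extChartAt_source]
    exact chartPartition_tsupport_subset c
  have hK : IsCompact (extChartAt I c '' tsupport (chartPartition I M c)) :=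
    (isClosed_tsupport _).isCompact.image_of_continuousOn ((continuousOn_extChartAt c).mono hsub)
  have hKt : extChartAt I c '' tsupport (chartPartition I M c) ⊆ (extChartAt I c).target := by
    rintro _ ⟨x, hx, rfl⟩
    exact (extChartAt I c).map_source (hsub hx)
  refine (((continuousOn_chartIntegrand o hη c).mono hKt).integrableOn_compact hK
    ).of_forall_sdiff_eq_zero (measurableSet_extChartAt_target c) ?_
  rintro y ⟨hy, hyK⟩
  have hρ : chartPartition I M c ((extChartAt I c).symm y) = 0 := by
    by_contra hne
    exact hyK ⟨_, subset_tsupport _ hne, (extChartAt I c).right_inv hy⟩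
  rw [chartIntegrand, hρ, mul_zero, zero_mul]

theorem integralForm_add (o : ManifoldOrientation I M) {η θ : DForm I M (m + 1)}
    (hη : IsSmoothForm η) (hθ : IsSmoothForm θ) :
    integralForm o (η + θ) = integralForm o η + integralForm o θ := by
  simp only [integralForm_eq_finsum]
  rw [← finsum_add_distrib
    (finite_support_chartPartition.subset (support_integral_chartIntegrand_subset o η))
    (finite_support_chartPartition.subset (support_integral_chartIntegrand_subset o θ))]
  refine finsum_congr fun c => ?_
  rw [← integral_add (integrableOn_chartIntegrand o hη c) (integrableOn_chartIntegrand o hθ c)]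
  simp only [chartIntegrand, Pi.add_apply, AlternatingMap.add_apply, mul_add]

theorem integralForm_smul (o : ManifoldOrientation I M) (r : ℝ) (η : DForm I M (m + 1)) :
    integralForm o (r • η) = r * integralForm o η := by
  simp only [integralForm_eq_finsum]
  rw [← smul_eq_mul, smul_finsum]
  refine finsum_congr fun c => ?_
  rw [smul_eq_mul, ← integral_const_mul]
  simp only [chartIntegrand, Pi.smul_apply, AlternatingMap.smul_apply, smul_eq_mul]
  congr 1
  funext y
  ring

theorem IsVariationalDerivative.integralForm_wedge_sub_eq_zero {o : ManifoldOrientation I M}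
    {k l : ℕ} {h : k + l = m + 1} {F : DForm I M k → ℝ} {a : DForm I M k} {e e' : DForm I M l}
    (he : IsVariationalDerivative o h F a e) (he' : IsVariationalDerivative o h F a e')
    {δ : DForm I M k} (hδ : IsSmoothForm δ) : integralForm o (wedge h δ (e - e')) = 0 := by
  have heq := (he.2 δ hδ).unique (he'.2 δ hδ)
  have hsub : wedge h δ e = wedge h δ (e - e') + wedge h δ e' := by
    funext x
    simp only [wedge, Pi.add_apply, Pi.sub_apply, altWedge_sub_right, sub_add_cancel]
  rw [hsub, integralForm_add o (hδ.wedge h (he.1.sub he'.1)) (hδ.wedge h he'.1)] at heq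
  linarith

variable [RiemannianBundle (fun x : M => TangentSpace I x)]
  [IsContMDiffRiemannianBundle I ∞ (EuclideanSpace ℝ (Fin (m + 1)))
      (fun x : M => TangentSpace I x)]

/-- A nonnegative function with integral zero vanishes. -/
theorem eq_zero_of_integralForm_fmul_volForm (o : ManifoldOrientation I M) {f : M → ℝ}
    (hf : ContMDiff I 𝓘(ℝ) ∞ f) (hf0 : ∀ x, 0 ≤ f x)
    (hint : integralForm o (fmul f (volForm o)) = 0) (x : M) : f x = 0 := by
  have hη : IsSmoothForm (fmul f (volForm o)) := (isSmoothForm_volForm o).fmul hf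
  have hval : ∀ c x, chartIntegrand o (fmul f (volForm o)) c x =
      chartPartition I M c x * f x * (chartSign o c x * volForm o x (coordFrame I c x)) := by
    intro c x
    rw [chartIntegrand, fmul, AlternatingMap.smul_apply, smul_eq_mul]
    ring
  have hnn : ∀ c, ∀ y ∈ (extChartAt I c).target,
      0 ≤ chartIntegrand o (fmul f (volForm o)) c ((extChartAt I c).symm y) := by
    intro c y hy
    have hs : (extChartAt I c).symm y ∈ (chartAt H c).source := by
      rw [← extChartAt_source I]
      exact (extChartAt I c).map_target hy
    rw [hval]
    exact mul_nonneg (mul_nonneg ((chartPartition I M).nonneg c _) (hf0 _))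
      (chartSign_mul_volForm_pos o hs).le
  have hzero : ∀ c, ∫ y in (extChartAt I c).target,
      chartIntegrand o (fmul f (volForm o)) c ((extChartAt I c).symm y) = 0 := by
    rw [integralForm_eq_finsum, finsum_eq_sum_of_support_subset (s :=
      finite_support_chartPartition.toFinset) _ (by
        rw [Set.Finite.coe_toFinset]
        exact support_integral_chartIntegrand_subset o _),
      Finset.sum_eq_zero_iff_of_nonneg fun c _ =>
        setIntegral_nonneg (measurableSet_extChartAt_target c) (hnn c)] at hint
    intro c
    by_contra hc
    exact hc (hint c (finite_support_chartPartition.mem_toFinset.2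
      (support_integral_chartIntegrand_subset o _ hc)))
  obtain ⟨c, hc⟩ := (chartPartition I M).exists_pos_of_mem (Set.mem_univ x)
  have hx : x ∈ (chartAt H c).source :=
    chartPartition_tsupport_subset c (subset_tsupport _ hc.ne')
  have hae := (setIntegral_eq_zero_iff_of_nonneg_ae
    ((ae_restrict_iff' (measurableSet_extChartAt_target c)).2 (Filter.Eventually.of_forall (hnn c)))
    (integrableOn_chartIntegrand o hη c)).1 (hzero c)
  have hEq := Measure.eqOn_of_ae_eq hae (continuousOn_chartIntegrand o hη c) continuousOn_const
    (extChartAt_target_subset_closure_interior_self c)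
  have hx' : x ∈ (extChartAt I c).source := by rwa [extChartAt_source]
  have h0 := hEq ((extChartAt I c).map_source hx')
  simp only [(extChartAt I c).left_inv hx', hval] at h0
  rcases mul_eq_zero.1 h0 with h | h
  · exact (mul_eq_zero.1 h).resolve_left hc.ne'
  · exact absurd h (chartSign_mul_volForm_pos o hx).ne'

theorem IsVariationalDerivative.unique_one_form {o : ManifoldOrientation I M}
    {F : DForm I M 1 → ℝ} {a : DForm I M 1} {e e' : DForm I M m}
    (he : IsVariationalDerivative o (Nat.add_comm 1 m) F a e)
    (he' : IsVariationalDerivative o (Nat.add_comm 1 m) F a e') : e = e' := by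
  have hγ : IsSmoothForm (e - e') := he.1.sub he'.1
  have hδ := isSmoothForm_cohodge o hγ
  have hint := he.integralForm_wedge_sub_eq_zero he' hδ
  have hform : wedge (Nat.add_comm 1 m) (cohodge o (e - e')) (e - e') =
      fmul (fun x => cohodge o (e - e') x (fun _ => sharp (cohodge o (e - e')) x))
        (volForm o) := by
    funext x
    refine (altWedge_altCohodge (o.at' x) ((e - e') x)).trans ?_
    rw [← real_inner_self_eq_norm_sq, inner_altSharp]
    rfl
  have hnorm : ∀ x, cohodge o (e - e') x (fun _ => sharp (cohodge o (e - e')) x) =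
      inner ℝ (altSharp (cohodge o (e - e') x)) (altSharp (cohodge o (e - e') x)) := fun x =>
    (inner_altSharp (cohodge o (e - e') x) _).symm
  rw [hform] at hint
  have hz := eq_zero_of_integralForm_fmul_volForm o (contMDiff_one_form_sharp hδ hδ)
    (fun x => by rw [hnorm]; exact real_inner_self_nonneg) hint
  funext x
  have hx := hz x
  rw [hnorm, inner_self_eq_zero] at hx
  exact sub_eq_zero.1 (eq_zero_of_altSharp_altCohodge_eq_zero (o.at' x) ((e - e') x) hx)

theorem IsVariationalDerivative.unique_top_form {o : ManifoldOrientation I M}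
    {F : DForm I M (m + 1) → ℝ} {a : DForm I M (m + 1)} {e e' : DForm I M 0}
    (he : IsVariationalDerivative o (Nat.add_zero (m + 1)) F a e)
    (he' : IsVariationalDerivative o (Nat.add_zero (m + 1)) F a e') : e = e' := by
  have hγ : IsSmoothForm (e - e') := he.1.sub he'.1
  have hf : ContMDiff I 𝓘(ℝ) ∞ (fun x => (e - e') x Fin.elim0) :=
    contMDiff_of_contMDiffOn_chart_source fun c => (hγ c Fin.elim0).congr fun x _ =>
      congrArg _ (Subsingleton.elim _ _)
  have hint := he.integralForm_wedge_sub_eq_zero he' ((isSmoothForm_volForm o).fmul hf)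
  have hform : wedge (Nat.add_zero (m + 1)) (fmul (fun x => (e - e') x Fin.elim0) (volForm o))
      (e - e') = fmul (fun x => (e - e') x Fin.elim0 * (e - e') x Fin.elim0) (volForm o) := by
    funext x
    rw [wedge, altWedge_zero_form, fmul, fmul, smul_smul]
  rw [hform] at hint
  have hz := eq_zero_of_integralForm_fmul_volForm o (hf.mul hf) (fun x => mul_self_nonneg _) hint
  funext x
  refine sub_eq_zero.1 (AlternatingMap.ext fun X => ?_)
  rw [Subsingleton.elim X Fin.elim0]
  exact mul_self_eq_zero.1 (hz x)

end Integration

section KineticEnergy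

variable {m : ℕ} {H : Type*} [TopologicalSpace H]
  {I : ModelWithCorners ℝ (EuclideanSpace ℝ (Fin (m + 1))) H}
  {M : Type*} [TopologicalSpace M] [ChartedSpace H M] [IsManifold I ∞ M]
  [RiemannianBundle (fun x : M => TangentSpace I x)]

theorem bijOn_velocityMap [IsContMDiffRiemannianBundle I ∞ (EuclideanSpace ℝ (Fin (m + 1)))
      (fun x : M => TangentSpace I x)] (o : ManifoldOrientation I M) :
    Set.BijOn (velocityMap o) (kineticStates o) (kineticStates o) := by
  refine Set.BijOn.mk ?_ ?_ ?_
  · rintro ⟨α, μ⟩ ⟨hα, hμ, h0⟩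
    refine ⟨hα.fmul ?_, hμ, h0⟩
    simp only [one_div]
    exact (contMDiff_density o hμ).inv₀ h0
  · rintro ⟨α, μ⟩ ⟨-, -, h0⟩ ⟨α', μ'⟩ - h
    obtain ⟨h1, rfl⟩ := Prod.ext_iff.1 h
    refine Prod.ext (funext fun x => ?_) rfl
    exact smul_right_injective _ (one_div_ne_zero (h0 x)) (congrFun h1 x)
  · rintro ⟨w, μ⟩ ⟨hw, hμ, h0⟩
    refine ⟨(fmul (density o μ) w, μ), ⟨hw.fmul (contMDiff_density o hμ), hμ, h0⟩, ?_⟩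
    refine Prod.ext (funext fun x => ?_) rfl
    simp only [velocityMap, fmul, smul_smul, one_div_mul_cancel (h0 x), one_smul]

variable [T2Space M] [CompactSpace M]

theorem kineticEnergyMomentum_eq (o : ManifoldOrientation I M)
    {s : DForm I M 1 × DForm I M (m + 1)} (hs : s ∈ kineticStates o) :
    kineticEnergyMomentum o s.1 s.2 =
      kineticEnergyVelocity o (velocityMap o s).1 (velocityMap o s).2 := by
  obtain ⟨α, μ⟩ := s
  have h0 : ∀ x, density o μ x ≠ 0 := hs.2.2
  unfold kineticEnergyMomentum kineticEnergyVelocity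
  congr 1
  funext x
  have hx := h0 x
  have hodge_eq : hodge o (Nat.add_comm 1 m) (fmul (fun x => 1 / density o μ x) α) x =
      (1 / density o μ x) • hodge o (Nat.add_comm 1 m) α x := altHodge_smul (o.at' x) _ _ _
  simp only [velocityMap, fmul, wedge] at hodge_eq ⊢
  rw [hodge_eq, altWedge_smul_left, altWedge_smul_right, smul_smul, smul_smul]
  congr 1
  field_simp

theorem kineticEnergyVelocity_eq (o : ManifoldOrientation I M) (w : DForm I M 1)
    (μ : DForm I M (m + 1)) :
    kineticEnergyVelocity o w μ =
      1 / 2 * integralForm o (fmul (fun x => w x (fun _ => sharp w x)) μ) := by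
  rw [← integralForm_smul, ← density_smul_wedge_hodge o]
  unfold kineticEnergyVelocity
  congr 1
  funext x
  simp only [fmul, Pi.smul_apply, smul_smul]

variable [IsContMDiffRiemannianBundle I ∞ (EuclideanSpace ℝ (Fin (m + 1)))
      (fun x : M => TangentSpace I x)]

theorem isVariationalDerivative_velocity (o : ManifoldOrientation I M) {w : DForm I M 1}
    {μ : DForm I M (m + 1)} (hw : IsSmoothForm w) (hμ : IsSmoothForm μ) :
    IsVariationalDerivative o (Nat.add_comm 1 m) (fun w' => kineticEnergyVelocity o w' μ) w
      (fmul (density o μ) (hodge o (Nat.add_comm 1 m) w)) := by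
  refine ⟨?_, fun δ hδ => ?_⟩
  · rw [density_smul_hodge]
    exact isSmoothForm_interiorProduct_sharp hw hμ
  have hpair : wedge (Nat.add_comm 1 m) δ (fmul (density o μ) (hodge o (Nat.add_comm 1 m) w)) =
      fmul (fun x => δ x (fun _ => sharp w x)) μ := by
    rw [← density_smul_wedge_hodge o]
    funext x
    simp only [wedge, fmul, altWedge_smul_right]
  have hww := hμ.fmul (contMDiff_one_form_sharp hw hw)
  have hdw := hμ.fmul (contMDiff_one_form_sharp hδ hw)
  have hdd := hμ.fmul (contMDiff_one_form_sharp hδ hδ)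
  have hexp : ∀ ε : ℝ, kineticEnergyVelocity o (w + ε • δ) μ =
      1 / 2 * integralForm o (fmul (fun x => w x (fun _ => sharp w x)) μ) +
      ε * integralForm o (fmul (fun x => δ x (fun _ => sharp w x)) μ) +
      ε ^ 2 * (1 / 2 * integralForm o (fmul (fun x => δ x (fun _ => sharp δ x)) μ)) := by
    intro ε
    have hsplit : fmul (fun x => (w + ε • δ) x (fun _ => sharp (w + ε • δ) x)) μ =
        fmul (fun x => w x (fun _ => sharp w x)) μ +
        ((2 * ε) • fmul (fun x => δ x (fun _ => sharp w x)) μ +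
          ε ^ 2 • fmul (fun x => δ x (fun _ => sharp δ x)) μ) := by
      funext x
      have hq : (w + ε • δ) x (fun _ => sharp (w + ε • δ) x) =
          w x (fun _ => sharp w x) + (2 * ε * δ x (fun _ => sharp w x) +
            ε ^ 2 * δ x (fun _ => sharp δ x)) := by
        have hs : sharp (w + ε • δ) x = altSharp (w x) + ε • altSharp (δ x) := by
          rw [← altSharp_smul, ← altSharp_add]
          rfl
        have hq' : inner ℝ (altSharp (w x) + ε • altSharp (δ x))
            (altSharp (w x) + ε • altSharp (δ x)) =
            inner ℝ (altSharp (w x)) (altSharp (w x)) +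
              (2 * ε * inner ℝ (altSharp (δ x)) (altSharp (w x)) +
                ε ^ 2 * inner ℝ (altSharp (δ x)) (altSharp (δ x))) := by
          simp only [inner_add_left, inner_add_right, real_inner_smul_left, real_inner_smul_right]
          rw [real_inner_comm (altSharp (δ x)) (altSharp (w x))]
          ring
        rw [← hs] at hq'
        have hl : inner ℝ (sharp (w + ε • δ) x) (sharp (w + ε • δ) x) =
          (w + ε • δ) x (fun _ => sharp (w + ε • δ) x) := inner_altSharp ((w + ε • δ) x) _
        rw [hl, inner_altSharp, inner_altSharp, inner_altSharp] at hq'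
        exact hq'
      simp only [fmul, Pi.add_apply, Pi.smul_apply, smul_smul, ← add_smul] at hq ⊢
      rw [hq]
    rw [kineticEnergyVelocity_eq, hsplit, integralForm_add o hww
      ((hdw.const_smul _).add (hdd.const_smul _)),
      integralForm_add o (hdw.const_smul _) (hdd.const_smul _), integralForm_smul, integralForm_smul]
    ring
  rw [hpair]
  simp only [hexp]
  have := ((hasDerivAt_const (0 : ℝ) (1 / 2 * integralForm o
    (fmul (fun x => w x (fun _ => sharp w x)) μ))).add ((hasDerivAt_id (0 : ℝ)).mul_const
      (integralForm o (fmul (fun x => δ x (fun _ => sharp w x)) μ)))).add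
      ((hasDerivAt_pow 2 (0 : ℝ)).mul_const
        (1 / 2 * integralForm o (fmul (fun x => δ x (fun _ => sharp δ x)) μ)))
  convert! this using 1
  simp

theorem isVariationalDerivative_mass (o : ManifoldOrientation I M) {w : DForm I M 1}
    {μ : DForm I M (m + 1)} (hw : IsSmoothForm w) (hμ : IsSmoothForm μ) :
    IsVariationalDerivative o (Nat.add_zero (m + 1)) (fun μ' => kineticEnergyVelocity o w μ') μ
      ((1 / 2 : ℝ) • interiorProduct (sharp w) w) := by
  refine ⟨(isSmoothForm_interiorProduct_sharp hw hw).const_smul _,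
    fun δ hδ => ?_⟩
  have hpair : wedge (Nat.add_zero (m + 1)) δ ((1 / 2 : ℝ) • interiorProduct (sharp w) w) =
      (1 / 2 : ℝ) • fmul (fun x => w x (fun _ => sharp w x)) δ := by
    funext x
    rw [wedge, altWedge_zero_form, Pi.smul_apply, AlternatingMap.smul_apply,
      interiorProduct_one_form_apply, Pi.smul_apply, fmul, smul_smul, smul_eq_mul]
  have hww := contMDiff_one_form_sharp hw hw
  have hexp : ∀ ε : ℝ, kineticEnergyVelocity o w (μ + ε • δ) =
      1 / 2 * integralForm o (fmul (fun x => w x (fun _ => sharp w x)) μ) +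
      ε * (1 / 2 * integralForm o (fmul (fun x => w x (fun _ => sharp w x)) δ)) := by
    intro ε
    have hsplit : fmul (fun x => w x (fun _ => sharp w x)) (μ + ε • δ) =
        fmul (fun x => w x (fun _ => sharp w x)) μ +
        ε • fmul (fun x => w x (fun _ => sharp w x)) δ := by
      funext x
      simp only [fmul, Pi.add_apply, Pi.smul_apply, smul_add]
      rw [smul_comm]
    rw [kineticEnergyVelocity_eq, hsplit, integralForm_add o (hμ.fmul hww)
      ((hδ.fmul hww).const_smul ε), integralForm_smul]
    ring
  rw [hpair, integralForm_smul]
  simp only [hexp]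
  have := (hasDerivAt_const (0 : ℝ) (1 / 2 * integralForm o
    (fmul (fun x => w x (fun _ => sharp w x)) μ))).add ((hasDerivAt_id (0 : ℝ)).mul_const
      (1 / 2 * integralForm o (fmul (fun x => w x (fun _ => sharp w x)) δ)))
  convert! this using 1
  simp

end KineticEnergy

theorem proposition5 {m : ℕ} {H : Type*} [TopologicalSpace H]
    (I : ModelWithCorners ℝ (EuclideanSpace ℝ (Fin (m + 1))) H)
    {M : Type*} [TopologicalSpace M] [T2Space M] [CompactSpace M] [ChartedSpace H M]
    [IsManifold I ∞ M] [RiemannianBundle (fun x : M => TangentSpace I x)]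
    [IsContMDiffRiemannianBundle I ∞ (EuclideanSpace ℝ (Fin (m + 1)))
      (fun x : M => TangentSpace I x)]
    (o : ManifoldOrientation I M) :
    -- the kinetic energy in the velocity variables `(w, μ) = (α / *μ, μ)`
    (Set.BijOn (velocityMap o) (kineticStates o) (kineticStates o) ∧
      ∀ s ∈ kineticStates o, kineticEnergyMomentum o s.1 s.2 =
        kineticEnergyVelocity o (velocityMap o s).1 (velocityMap o s).2) ∧
    -- the variational derivatives
    ∀ (w : DForm I M 1) (μ : DForm I M (m + 1)), IsSmoothForm w → IsSmoothForm μ →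
      (∀ e : DForm I M m,
        IsVariationalDerivative o (Nat.add_comm 1 m) (fun w' => kineticEnergyVelocity o w' μ) w e ↔
          e = fmul (density o μ) (hodge o (Nat.add_comm 1 m) w)) ∧
      fmul (density o μ) (hodge o (Nat.add_comm 1 m) w) = interiorProduct (sharp w) μ ∧
      (∀ e : DForm I M 0,
        IsVariationalDerivative o (Nat.add_zero (m + 1)) (fun μ' => kineticEnergyVelocity o w μ') μ e ↔
          e = (1 / 2 : ℝ) • interiorProduct (sharp w) w) := by
  refine ⟨⟨bijOn_velocityMap o, fun s hs => kineticEnergyMomentum_eq o hs⟩, fun w μ hw hμ =>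
    ⟨fun e => ⟨fun he => he.unique_one_form (isVariationalDerivative_velocity o hw hμ), ?_⟩,
      density_smul_hodge o w μ,
      fun e => ⟨fun he => he.unique_top_form (isVariationalDerivative_mass o hw hμ), ?_⟩⟩⟩
  · rintro rfl
    exact isVariationalDerivative_velocity o hw hμ
  · rintro rfl
    exact isVariationalDerivative_mass o hw hμ
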